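/- Consider a downlink with $N_t$ transmit antennas, $N$ legitimate users, $M\ge 1$ eavesdroppers and $I\ge 0$ energy-harvesting nodes. The following data are given: a bandwidth $B>0$; user channels $h_n\in\mathbb C^{N_t}$ with $H_n=h_nh_n^{H}$ and noise variances $\sigma_{u,n}^2$; estimated eavesdropper channels $\bar g_{e,m}\in\mathbb C^{N_t}$ with uncertainty radii $\Theta_{e,m}>0$ and noise variances $\sigma_{e,m}^2$; leakage-rate thresholds $R_{m,n}>0$, with $\widetilde R_{m,n}=R_{m,n}/B$; estimated harvester channels $\bar g_{h,i}\in\mathbb C^{N_t}$ with uncertainty radii $\Theta_{h,i}>0$, conversion efficiencies $\xi_i\in(0,1]$ and energy requirements $P_i\in\mathbb R$; and proportions $\varphi_n\ge 0$ with $\sum_n\varphi_n=1$. Put $\widetilde G_{e,m}=[I_{N_t},\bar g_{e,m}]$, $\widetilde G_{h,i}=[I_{N_t},\bar g_{h,i}]$ and $\theta_n(t)=\exp\left(\varphi_n t/B+\max_m\widetilde R_{m,n}\right)-1$. Fix $t\in\mathbb R$ such that $\theta_n(t)\neq 0$ for all $n$ (this holds for every $t\ge 0$), and consider the semidefinite program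 \[ \min\ \sum_{n=1}^N\mathrm{Tr}(W_n)+\mathrm{Tr}(Q) \] over $N_t\times N_t$ complex matrices $W_1,\dots,W_N,Q$ and reals $\zeta_{m,n}$, $\eta_i$, subject to, for all $m,n,i$: \[ \zeta_{m,n}\ge 0,\qquad \eta_i\ge 0,\qquad Q\succeq 0,\qquad W_n\succeq 0, \] \[ \begin{bmatrix}\zeta_{m,n}I_{N_t}&0\\0&\sigma_{e,m}^2-\zeta_{m,n}\Theta_{e,m}^2\end{bmatrix}-\widetilde G_{e,m}^{H}\left(\frac{1}{1-e^{-\widetilde R_{m,n}}}W_n-\sum_{k=1}^N W_k-Q\right)\widetilde G_{e,m}\succeq 0, \] \[ \begin{bmatrix}\eta_iI_{N_t}&0\\0&-\frac{P_i}{\xi_i}-\eta_i\Theta_{h,i}^2\end{bmatrix}+\widetilde G_{h,i}^{H}\left(\sum_{k=1}^N W_k+Q\right)\widetilde G_{h,i}\succeq 0, \] \[ \frac{1+\theta_n(t)}{\theta_n(t)}\mathrm{Tr}(H_nW_n)\ge\sum_{k=1}^N\mathrm{Tr}(H_nW_k)+\mathrm{Tr}(H_nQ)+\sigma_{u,n}^2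 . \] If this program is feasible, then it has an optimal solution $(\{W_n^*\},Q^*,\{\zeta_{m,n}^*\},\{\eta_i^*\})$ with $\mathrm{Rank}(W_n^*)\le 1$ for all $n$. -/

import Mathlib

open scoped ComplexOrder Matrix

namespace MisomeSwipt

/-- The parameters of a downlink system with `Nt` transmit antennas, `N` legitimate users,
`M` eavesdroppers and `I` energy-harvesting nodes. Indices: `n : Fin N` for a user, `m : Fin M` for
an eavesdropper, `i : Fin I` for an energy-harvesting node. -/
structure System (Nt N M I : ℕ) where
  /-- bandwidth -/
  BW : ℝ
  BW_pos : 0 < BW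
  /-- channel vector `h n` of user `n` (perfectly known) -/
  h : Fin N → Fin Nt → ℂ
  /-- `σu n ^ 2` is the noise variance at user `n` -/
  σu : Fin N → ℝ
  /-- estimated channel vector of eavesdropper `m` -/
  ge : Fin M → Fin Nt → ℂ
  /-- radius of the uncertainty region of the channel of eavesdropper `m` -/
  Θe : Fin M → ℝ
  Θe_pos : ∀ m, 0 < Θe m
  /-- `σe m ^ 2` is the noise variance at eavesdropper `m` -/
  σe : Fin M → ℝ
  /-- threshold `Rreq m n` on the rate leaked to eavesdropper `m` about user `n` -/
  Rreq : Fin M → Fin N → ℝ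
  Rreq_pos : ∀ m n, 0 < Rreq m n
  /-- estimated channel vector of energy-harvesting node `i` -/
  gh : Fin I → Fin Nt → ℂ
  /-- radius of the uncertainty region of the channel of energy-harvesting node `i` -/
  Θh : Fin I → ℝ
  Θh_pos : ∀ i, 0 < Θh i
  /-- energy conversion efficiency of node `i` -/
  ξ : Fin I → ℝ
  ξ_pos : ∀ i, 0 < ξ i
  ξ_le_one : ∀ i, ξ i ≤ 1
  /-- energy requirement of node `i` -/
  Preq : Fin I → ℝ
  /-- secrecy-rate proportions -/
  φ : Fin N → ℝ
  φ_nonneg : ∀ n, 0 ≤ φ n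
  φ_sum : ∑ n, φ n = 1

/-- The decision variables: beamforming matrices `W n`, artificial-noise covariance `Q`, and the
auxiliary scalars `ζ m n` and `η i`. -/
structure Variables (Nt N M I : ℕ) where
  W : Fin N → Matrix (Fin Nt) (Fin Nt) ℂ
  Q : Matrix (Fin Nt) (Fin Nt) ℂ
  ζ : Fin M → Fin N → ℝ
  η : Fin I → ℝ

variable {Nt N M I : ℕ}

/-- Real part of the trace. It is applied only to positive semidefinite matrices `W` and to products
`H * W` of two such matrices, whose traces are real. -/
noncomputable def reTr (A : Matrix (Fin Nt) (Fin Nt) ℂ) : ℝ := A.trace.re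

/-- The augmented channel matrix `[I, g]`, of size `Nt × (Nt + 1)`. -/
def augment (g : Fin Nt → ℂ) : Matrix (Fin Nt) (Fin Nt ⊕ Unit) ℂ :=
  Matrix.fromCols 1 (Matrix.replicateCol Unit g)

/-- The block-diagonal matrix `diag (a I, b)`, of size `Nt + 1`. -/
noncomputable def blockDiag (Nt : ℕ) (a b : ℝ) : Matrix (Fin Nt ⊕ Unit) (Fin Nt ⊕ Unit) ℂ :=
  Matrix.fromBlocks ((a : ℂ) • 1) 0 0 ((b : ℂ) • 1)

namespace Variables

/-- The total transmit covariance `∑ n, W n + Q`. -/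
noncomputable def Y (x : Variables Nt N M I) : Matrix (Fin Nt) (Fin Nt) ℂ :=
  ∑ n, x.W n + x.Q

/-- The total transmit power. -/
noncomputable def power (x : Variables Nt N M I) : ℝ :=
  ∑ n, reTr (x.W n) + reTr x.Q

end Variables

namespace System

/-- The normalized leakage threshold. -/
noncomputable def Rtilde (S : System Nt N M I) (m : Fin M) (n : Fin N) : ℝ :=
  S.Rreq m n / S.BW

/-- `H n = h n * (h n)ᴴ`. -/
noncomputable def H (S : System Nt N M I) (n : Fin N) : Matrix (Fin Nt) (Fin Nt) ℂ :=
  Matrix.vecMulVec (S.h n) (star (S.h n))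

/-- `θ n t = exp (φ n t / BW + max over m of Rtilde m n) - 1`. -/
noncomputable def θ [NeZero M] (S : System Nt N M I) (n : Fin N) (t : ℝ) : ℝ :=
  Real.exp (S.φ n * t / S.BW +
    Finset.univ.sup' Finset.univ_nonempty (fun m : Fin M => S.Rtilde m n)) - 1

/-- The matrix `(1 / (1 - exp (-Rtilde m n))) W n - ∑ k, W k - Q`. -/
noncomputable def X (S : System Nt N M I) (x : Variables Nt N M I) (m : Fin M) (n : Fin N) :
    Matrix (Fin Nt) (Fin Nt) ℂ :=
  ((1 / (1 - Real.exp (-S.Rtilde m n)) : ℝ) : ℂ) • x.W n - ∑ k, x.W k - x.Q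

/-- The robust leakage matrix inequality for eavesdropper `m` and user `n`. -/
def LeakageLMI (S : System Nt N M I) (x : Variables Nt N M I) (m : Fin M) (n : Fin N) : Prop :=
  (blockDiag Nt (x.ζ m n) (S.σe m ^ 2 - x.ζ m n * S.Θe m ^ 2)
    - (augment (S.ge m))ᴴ * S.X x m n * augment (S.ge m)).PosSemidef

/-- The robust energy-harvesting matrix inequality for node `i`. -/
def HarvestLMI (S : System Nt N M I) (x : Variables Nt N M I) (i : Fin I) : Prop :=
  (blockDiag Nt (x.η i) (-(S.Preq i / S.ξ i) - x.η i * S.Θh i ^ 2)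
    + (augment (S.gh i))ᴴ * x.Y * augment (S.gh i)).PosSemidef

/-- The relaxed proportional secrecy-rate constraint for user `n`. -/
def SecrecyConstraint [NeZero M] (S : System Nt N M I) (t : ℝ) (x : Variables Nt N M I)
    (n : Fin N) : Prop :=
  ∑ k, reTr (S.H n * x.W k) + reTr (S.H n * x.Q) + S.σu n ^ 2
    ≤ (1 + S.θ n t) / S.θ n t * reTr (S.H n * x.W n)

/-- The feasible set of the relaxed semidefinite program at the value `t`. -/
def feasible [NeZero M] (S : System Nt N M I) (t : ℝ) : Set (Variables Nt N M I) :=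
  {x | (∀ m n, 0 ≤ x.ζ m n) ∧ (∀ i, 0 ≤ x.η i) ∧
    x.Q.PosSemidef ∧ (∀ n, (x.W n).PosSemidef) ∧
    (∀ m n, S.LeakageLMI x m n) ∧ (∀ i, S.HarvestLMI x i) ∧ (∀ n, S.SecrecyConstraint t x n)}

/-- `x` is an optimal solution of the relaxed semidefinite program at the value `t`: it is feasible
and has the least transmit power among all feasible points. -/
def IsOptimal [NeZero M] (S : System Nt N M I) (t : ℝ) (x : Variables Nt N M I) : Prop :=
  x ∈ S.feasible t ∧ ∀ y ∈ S.feasible t, x.power ≤ y.power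

end System

end MisomeSwipt

/-!
An optimal solution exists by compactness, and any optimal solution can be turned into one with
beamformers of rank at most one without changing its cost.

*Existence.* A positive semidefinite matrix has all its entries bounded by its trace
(`norm_apply_le_reTr`), so a bound on the power bounds every `W n` and `Q`. The bottom right entry
of each matrix inequality then bounds `ζ m n` and `η i` from above, because the uncertainty radii
are positive. All constraints are closed conditions, so the feasible points of power at most that
of a given feasible point form a compact set, and the continuous power function attains its minimum
there (`exists_isOptimal`).

*Rank reduction.* Replace `W n` by `V n = W n h hᴴ W n / (hᴴ W n h)`, with `h = h n`, and move the
differences `W n - V n` into `Q`. By the Cauchy-Schwarz inequality for the form given by `W n`,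
`V n ≤ W n` in the Loewner order, so the new `Q` is positive semidefinite. The total covariance
`∑ n, W n + Q` is unchanged, hence so are the power and the harvesting constraints. As
`hᴴ (V n) h = hᴴ (W n) h`, the secrecy constraints are unchanged too, whatever the sign of the
coefficient in them. The matrix `X` of each leakage constraint decreases, which only relaxes the
constraint.
-/

namespace MisomeSwipt

open Matrix

variable {Nt N M I : ℕ}

/-! ### Linear-algebraic preliminaries -/

theorem reTr_nonneg {A : Matrix (Fin Nt) (Fin Nt) ℂ} (hA : A.PosSemidef) : 0 ≤ reTr A :=
  (Complex.nonneg_iff.mp hA.trace_nonneg).1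

theorem reTr_add (A B : Matrix (Fin Nt) (Fin Nt) ℂ) : reTr (A + B) = reTr A + reTr B := by
  simp [reTr, trace_add]

theorem reTr_sum {ι : Type*} (s : Finset ι) (A : ι → Matrix (Fin Nt) (Fin Nt) ℂ) :
    reTr (∑ k ∈ s, A k) = ∑ k ∈ s, reTr (A k) := by
  simp [reTr, trace_sum]

theorem continuous_reTr : Continuous (reTr : Matrix (Fin Nt) (Fin Nt) ℂ → ℝ) :=
  Complex.continuous_re.comp continuous_id.matrix_trace

/-- Every entry of a positive semidefinite matrix is bounded by the trace: the `2 × 2` principal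
minors are nonnegative, and each diagonal entry is at most the trace. -/
theorem norm_apply_le_reTr {A : Matrix (Fin Nt) (Fin Nt) ℂ} (hA : A.PosSemidef) (i j : Fin Nt) :
    ‖A i j‖ ≤ reTr A := by
  have hd : ∀ k, 0 ≤ (A k k).re ∧ (A k k).im = 0 := fun k => by
    have := Complex.nonneg_iff.mp (hA.diag_nonneg (i := k))
    exact ⟨this.1, this.2.symm⟩
  have hle : ∀ k, (A k k).re ≤ reTr A := fun k => by
    simp only [reTr, trace, diag_apply, Complex.re_sum]
    exact Finset.single_le_sum (f := fun l => (A l l).re) (fun l _ => (hd l).1)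
      (Finset.mem_univ k)
  have hdet := (Complex.nonneg_iff.mp (hA.submatrix ![i, j]).det_nonneg).1
  have hji : A j i = star (A i j) := (hA.isHermitian.apply j i).symm
  simp only [det_fin_two, submatrix_apply, cons_val_zero, cons_val_one, hji, Complex.sub_re,
    Complex.mul_re, (hd i).2, Complex.star_def, Complex.conj_re, Complex.conj_im] at hdet
  have hsq : ‖A i j‖ ^ 2 ≤ reTr A ^ 2 := by
    rw [← Complex.normSq_eq_norm_sq, Complex.normSq_apply]
    nlinarith [mul_le_mul (hle i) (hle j) (hd j).1 ((hd i).1.trans (hle i))]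
  exact (sq_le_sq₀ (norm_nonneg _) (reTr_nonneg hA)).mp hsq

theorem isClosed_setOf_posSemidef {n : Type*} [Fintype n] :
    IsClosed {A : Matrix n n ℂ | A.PosSemidef} := by
  simp only [posSemidef_iff_dotProduct_mulVec, Set.ofPred_and, Set.ofPred_forall]
  refine (isClosed_eq continuous_id.matrix_conjTranspose continuous_id).inter
    (isClosed_iInter fun x => isClosed_le continuous_const ?_)
  exact continuous_const.dotProduct (continuous_id.matrix_mulVec continuous_const)

theorem isCompact_setOf_norm_apply_le {m n : Type*} (c : ℝ) :
    IsCompact {A : Matrix m n ℂ | ∀ i j, ‖A i j‖ ≤ c} := by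
  have := isCompact_univ_pi fun _ : m => isCompact_univ_pi fun _ : n =>
    isCompact_closedBall (0 : ℂ) c
  have h : (Set.univ.pi fun _ : m => Set.univ.pi fun _ : n => Metric.closedBall (0 : ℂ) c) =
      {A : m → n → ℂ | ∀ i j, ‖A i j‖ ≤ c} := by
    ext A
    simp [Set.mem_pi]
  rw [h] at this
  exact this

theorem nonneg_of_posSemidef_blockDiag_add {a b : ℝ} {E : Matrix (Fin Nt ⊕ Unit) (Fin Nt ⊕ Unit) ℂ}
    (h : (blockDiag Nt a b + E).PosSemidef) : 0 ≤ b + (E (.inr ()) (.inr ())).re := by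
  simpa [blockDiag] using (Complex.nonneg_iff.mp (h.diag_nonneg (i := .inr ()))).1

/-! ### Existence of an optimal solution -/

/-- The decision variables as a tuple, which carries the product topology. -/
abbrev VariableTuple (Nt N M I : ℕ) : Type :=
  (Fin N → Matrix (Fin Nt) (Fin Nt) ℂ) × Matrix (Fin Nt) (Fin Nt) ℂ × (Fin M → Fin N → ℝ) ×
    (Fin I → ℝ)

/-- The decision variables given by a tuple. -/
def VariableTuple.toVariables (p : VariableTuple Nt N M I) : Variables Nt N M I :=
  ⟨p.1, p.2.1, p.2.2.1, p.2.2.2⟩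

open VariableTuple

theorem continuous_power :
    Continuous fun p : VariableTuple Nt N M I => (toVariables p).power := by
  refine Continuous.add (continuous_finsetSum _ fun n _ => continuous_reTr.comp ?_)
    (continuous_reTr.comp ?_)
  · exact (continuous_apply n).comp continuous_fst
  · exact continuous_fst.comp continuous_snd

theorem continuous_Y : Continuous fun p : VariableTuple Nt N M I => (toVariables p).Y := by
  unfold Variables.Y toVariables
  fun_prop

theorem continuous_blockDiag {T : Type*} [TopologicalSpace T] {a b : T → ℝ} (ha : Continuous a)
    (hb : Continuous b) : Continuous fun p => blockDiag Nt (a p) (b p) := by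
  unfold blockDiag
  refine Continuous.matrix_fromBlocks ?_ continuous_const continuous_const ?_
  · exact (Complex.continuous_ofReal.comp ha).smul continuous_const
  · exact (Complex.continuous_ofReal.comp hb).smul continuous_const

namespace System

variable (S : System Nt N M I)

theorem continuous_X (m : Fin M) (n : Fin N) :
    Continuous fun p : VariableTuple Nt N M I => S.X (toVariables p) m n := by
  unfold X toVariables
  fun_prop

theorem continuous_leakage_term (m : Fin M) (n : Fin N) :
    Continuous fun p : VariableTuple Nt N M I =>
      (augment (S.ge m))ᴴ * S.X (toVariables p) m n * augment (S.ge m) :=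
  (continuous_const.matrix_mul (S.continuous_X m n)).matrix_mul continuous_const

theorem continuous_harvest_term (i : Fin I) :
    Continuous fun p : VariableTuple Nt N M I =>
      (augment (S.gh i))ᴴ * (toVariables p).Y * augment (S.gh i) :=
  (continuous_const.matrix_mul continuous_Y).matrix_mul continuous_const

theorem isClosed_preimage_feasible [NeZero M] (t : ℝ) :
    IsClosed {p : VariableTuple Nt N M I | toVariables p ∈ S.feasible t} := by
  have hW : ∀ n, Continuous fun p : VariableTuple Nt N M I => (toVariables p).W n := fun n =>
    (continuous_apply n).comp continuous_fst
  have hQ : Continuous fun p : VariableTuple Nt N M I => (toVariables p).Q :=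
    continuous_fst.comp continuous_snd
  have hζ : ∀ m n, Continuous fun p : VariableTuple Nt N M I => (toVariables p).ζ m n := by
    unfold toVariables
    fun_prop
  have hη : ∀ i, Continuous fun p : VariableTuple Nt N M I => (toVariables p).η i := by
    unfold toVariables
    fun_prop
  have hH : ∀ n {f : VariableTuple Nt N M I → Matrix (Fin Nt) (Fin Nt) ℂ}, Continuous f →
      Continuous fun p => reTr (S.H n * f p) := fun n f hf =>
    continuous_reTr.comp (continuous_const.matrix_mul hf)
  change IsClosed {p : VariableTuple Nt N M I | _ ∧ _ ∧ _ ∧ _ ∧ _ ∧ _ ∧ _}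
  simp only [Set.ofPred_and, Set.ofPred_forall]
  refine IsClosed.inter ?_ <| .inter ?_ <| .inter ?_ <| .inter ?_ <| .inter ?_ <| .inter ?_ ?_
  · exact isClosed_iInter fun m => isClosed_iInter fun n => isClosed_le continuous_const (hζ m n)
  · exact isClosed_iInter fun i => isClosed_le continuous_const (hη i)
  · exact isClosed_setOf_posSemidef.preimage hQ
  · exact isClosed_iInter fun n => isClosed_setOf_posSemidef.preimage (hW n)
  · exact isClosed_iInter fun m => isClosed_iInter fun n => isClosed_setOf_posSemidef.preimage <|
      (continuous_blockDiag (hζ m n) (continuous_const.sub ((hζ m n).mul continuous_const))).sub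
        (S.continuous_leakage_term m n)
  · exact isClosed_iInter fun i => isClosed_setOf_posSemidef.preimage <|
      (continuous_blockDiag (hη i) (continuous_const.sub ((hη i).mul continuous_const))).add
        (S.continuous_harvest_term i)
  · exact isClosed_iInter fun n => isClosed_le
      (((continuous_finsetSum _ fun k _ => hH n (hW k)).add (hH n hQ)).add continuous_const)
      (continuous_const.mul (hH n (hW n)))

/-- The trace bounds the entries of the matrices, and the bottom right entry of each matrix inequality,
divided by the squared radius, bounds the corresponding scalar. -/
theorem isCompact_sublevel [NeZero M] (t c : ℝ) :
    IsCompact {p : VariableTuple Nt N M I |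
      toVariables p ∈ S.feasible t ∧ (toVariables p).power ≤ c} := by
  have hK := isCompact_setOf_norm_apply_le (m := Fin Nt) (n := Fin Nt) c
  have hKW := isCompact_univ_pi fun _ : Fin N => hK
  -- The matrices `X` and `Y` do not involve the scalars, which may be set to zero.
  have hc : Continuous fun q : (Fin N → Matrix (Fin Nt) (Fin Nt) ℂ) × Matrix (Fin Nt) (Fin Nt) ℂ =>
      ((q.1, q.2, 0, 0) : VariableTuple Nt N M I) := by fun_prop
  have hX : ∀ m n, ∃ C, ∀ q ∈ (Set.univ.pi fun _ : Fin N => _) ×ˢ _, _ ≤ C := fun m n => by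
    obtain ⟨C, hC⟩ := (hKW.prod hK).bddAbove_image (Complex.continuous_re.comp
      (((S.continuous_leakage_term m n).comp hc).matrix_elem (.inr ()) (.inr ()))).neg.continuousOn
    exact ⟨C, fun q hq => hC (Set.mem_image_of_mem _ hq)⟩
  have hY : ∀ i, ∃ C, ∀ q ∈ (Set.univ.pi fun _ : Fin N => _) ×ˢ _, _ ≤ C := fun i => by
    obtain ⟨C, hC⟩ := (hKW.prod hK).bddAbove_image (Complex.continuous_re.comp
      (((S.continuous_harvest_term i).comp hc).matrix_elem (.inr ()) (.inr ()))).continuousOn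
    exact ⟨C, fun q hq => hC (Set.mem_image_of_mem _ hq)⟩
  choose CX hCX using hX
  choose CY hCY using hY
  have hcompact := hKW.prod <| hK.prod <|
    (isCompact_univ_pi fun m : Fin M => isCompact_univ_pi fun n : Fin N =>
      isCompact_Icc (a := (0 : ℝ)) (b := (S.σe m ^ 2 + CX m n) / S.Θe m ^ 2)).prod <|
    isCompact_univ_pi fun i : Fin I =>
      isCompact_Icc (a := (0 : ℝ)) (b := (-(S.Preq i / S.ξ i) + CY i) / S.Θh i ^ 2)
  refine hcompact.of_isClosed_subset
    ((S.isClosed_preimage_feasible t).inter (isClosed_le continuous_power continuous_const)) ?_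
  rintro ⟨W, Q, ζ, η⟩ ⟨⟨hζ, hη, hQ, hW, hL, hE, -⟩, hp⟩
  simp only [toVariables, Variables.power] at hζ hη hQ hW hp
  have hWc : ∀ n, reTr (W n) ≤ c := fun n => by
    have := Finset.single_le_sum (f := fun k => reTr (W k)) (fun k _ => reTr_nonneg (hW k))
      (Finset.mem_univ n)
    linarith [reTr_nonneg hQ]
  have hQc : reTr Q ≤ c := by
    linarith [Finset.sum_nonneg fun k (_ : k ∈ Finset.univ) => reTr_nonneg (hW k)]
  have hWK : W ∈ Set.univ.pi fun _ : Fin N =>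
      {A : Matrix (Fin Nt) (Fin Nt) ℂ | ∀ i j, ‖A i j‖ ≤ c} :=
    fun n _ i j => (norm_apply_le_reTr (hW n) i j).trans (hWc n)
  have hQK : Q ∈ {A : Matrix (Fin Nt) (Fin Nt) ℂ | ∀ i j, ‖A i j‖ ≤ c} :=
    fun i j => (norm_apply_le_reTr hQ i j).trans hQc
  refine ⟨hWK, hQK, fun m _ n _ => ⟨hζ m n, ?_⟩, fun i _ => ⟨hη i, ?_⟩⟩
  · rw [le_div_iff₀ (pow_pos (S.Θe_pos m) 2)]
    have h1 := hCX m n (W, Q) ⟨hWK, hQK⟩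
    have h2 := hL m n
    rw [LeakageLMI, sub_eq_add_neg] at h2
    have h3 := nonneg_of_posSemidef_blockDiag_add h2
    rw [Matrix.neg_apply, Complex.neg_re] at h3
    have h4 := h3.trans (add_le_add_right h1 _)
    simp only [toVariables] at h4
    linarith
  · rw [le_div_iff₀ (pow_pos (S.Θh_pos i) 2)]
    have h1 := hCY i (W, Q) ⟨hWK, hQK⟩
    have h3 := nonneg_of_posSemidef_blockDiag_add (hE i)
    have h4 := h3.trans (add_le_add_right h1 _)
    simp only [toVariables] at h4
    linarith

theorem exists_isOptimal [NeZero M] (t : ℝ) (hfeas : (S.feasible t).Nonempty) :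
    ∃ x, S.IsOptimal t x := by
  obtain ⟨x₀, hx₀⟩ := hfeas
  obtain ⟨p, hp, hmin⟩ := (S.isCompact_sublevel t x₀.power).exists_isMinOn
    ⟨(x₀.W, x₀.Q, x₀.ζ, x₀.η), hx₀, le_rfl⟩ continuous_power.continuousOn
  refine ⟨toVariables p, hp.1, fun y hy => ?_⟩
  rcases le_total y.power x₀.power with h | h
  · exact hmin (a := (y.W, y.Q, y.ζ, y.η)) ⟨hy, h⟩
  · exact hp.2.trans h

end System

/-! ### Rank reduction -/

/-- The rank-one part `W v vᴴ W / (vᴴ W v)` of a Hermitian matrix `W` in the direction `v`; it is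
`0` if `vᴴ W v = 0`. -/
noncomputable def rankOnePart (W : Matrix (Fin Nt) (Fin Nt) ℂ) (v : Fin Nt → ℂ) :
    Matrix (Fin Nt) (Fin Nt) ℂ :=
  (star v ⬝ᵥ W *ᵥ v)⁻¹ • (W * vecMulVec v (star v) * W)

theorem vecMulVec_star_mul_mul (W : Matrix (Fin Nt) (Fin Nt) ℂ) (v : Fin Nt → ℂ) :
    vecMulVec v (star v) * W * vecMulVec v (star v) =
      (star v ⬝ᵥ W *ᵥ v) • vecMulVec v (star v) := by
  rw [vecMulVec_mul, vecMulVec_mul_vecMulVec, dotProduct_mulVec, vecMulVec_smul]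

theorem rank_rankOnePart_le (W : Matrix (Fin Nt) (Fin Nt) ℂ) (v : Fin Nt → ℂ) :
    (rankOnePart W v).rank ≤ 1 := by
  rw [rankOnePart, mul_vecMulVec, vecMulVec_mul, ← smul_vecMulVec]
  exact rank_vecMulVec_le _ _

theorem trace_vecMulVec_star_mul (W : Matrix (Fin Nt) (Fin Nt) ℂ) (v : Fin Nt → ℂ) :
    (vecMulVec v (star v) * W).trace = star v ⬝ᵥ W *ᵥ v := by
  rw [vecMulVec_mul, trace_vecMulVec, dotProduct_comm, dotProduct_mulVec]

theorem trace_vecMulVec_star_mul_rankOnePart (W : Matrix (Fin Nt) (Fin Nt) ℂ) (v : Fin Nt → ℂ) :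
    (vecMulVec v (star v) * rankOnePart W v).trace = (vecMulVec v (star v) * W).trace := by
  rw [rankOnePart, Matrix.mul_smul, ← mul_assoc, ← mul_assoc, vecMulVec_star_mul_mul, smul_mul_assoc,
    smul_smul, trace_smul, trace_vecMulVec_star_mul, smul_eq_mul]
  rcases eq_or_ne (star v ⬝ᵥ W *ᵥ v) 0 with h | h
  · simp [h]
  · rw [inv_mul_cancel₀ h, one_mul]

theorem posSemidef_rankOnePart {W : Matrix (Fin Nt) (Fin Nt) ℂ} (hW : W.PosSemidef)
    (v : Fin Nt → ℂ) : (rankOnePart W v).PosSemidef := by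
  have h := (posSemidef_vecMulVec_self_star v).mul_mul_conjTranspose_same W
  rw [hW.isHermitian.eq] at h
  exact h.smul (inv_nonneg.mpr (hW.dotProduct_mulVec_nonneg v))

/-- The Cauchy-Schwarz inequality for the form given by `W`. With `P = 1 - v vᴴ W / (vᴴ W v)`, the
projection along `v` that is orthogonal for this form, the difference equals `Pᴴ W P`. -/
theorem posSemidef_sub_rankOnePart {W : Matrix (Fin Nt) (Fin Nt) ℂ} (hW : W.PosSemidef)
    (v : Fin Nt → ℂ) : (W - rankOnePart W v).PosSemidef := by
  rcases eq_or_ne (star v ⬝ᵥ W *ᵥ v) 0 with h | h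
  · simpa [rankOnePart, h] using hW
  have hreal : star (star v ⬝ᵥ W *ᵥ v) = star v ⬝ᵥ W *ᵥ v :=
    (IsSelfAdjoint.of_nonneg (hW.dotProduct_mulVec_nonneg v)).star_eq
  have hP := hW.conjTranspose_mul_mul_same
    (1 - (star v ⬝ᵥ W *ᵥ v)⁻¹ • (vecMulVec v (star v) * W))
  convert hP using 1
  have hV : (vecMulVec v (star v))ᴴ = vecMulVec v (star v) :=
    (posSemidef_vecMulVec_self_star v).isHermitian.eq
  have hmul : W * vecMulVec v (star v) * W * (vecMulVec v (star v) * W) =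
      (star v ⬝ᵥ W *ᵥ v) • (W * vecMulVec v (star v) * W) := by
    rw [← mul_assoc, mul_assoc W, mul_assoc W, vecMulVec_star_mul_mul, Matrix.mul_smul,
      smul_mul_assoc, mul_assoc]
  rw [conjTranspose_sub, conjTranspose_one, conjTranspose_smul, conjTranspose_mul,
    hW.isHermitian.eq, hV, star_inv₀, hreal, rankOnePart, sub_mul, one_mul, smul_mul_assoc,
    mul_sub, mul_one, sub_mul, Matrix.mul_smul, Matrix.mul_smul, smul_mul_assoc, hmul,
    inv_smul_smul₀ h, ← mul_assoc, sub_self, sub_zero]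

namespace System

variable (S : System Nt N M I)

/-- Every beamforming matrix is replaced by its rank-one part in the direction of the user's
channel, and the remainders are added to the artificial noise. -/
noncomputable def reduceRank (x : Variables Nt N M I) : Variables Nt N M I where
  W n := rankOnePart (x.W n) (S.h n)
  Q := x.Q + ∑ n, (x.W n - rankOnePart (x.W n) (S.h n))
  ζ := x.ζ
  η := x.η

theorem Y_reduceRank (x : Variables Nt N M I) : (S.reduceRank x).Y = x.Y := by
  simp only [reduceRank, Variables.Y, Finset.sum_sub_distrib]
  abel

theorem power_eq_reTr_Y (x : Variables Nt N M I) : x.power = reTr x.Y := by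
  rw [Variables.power, Variables.Y, reTr_add, reTr_sum]

theorem X_eq_sub_Y (x : Variables Nt N M I) (m : Fin M) (n : Fin N) :
    S.X x m n = ((1 / (1 - Real.exp (-S.Rtilde m n)) : ℝ) : ℂ) • x.W n - x.Y := by
  rw [X, Variables.Y, sub_sub]

theorem reTr_H_mul_Y (x : Variables Nt N M I) (n : Fin N) :
    reTr (S.H n * x.Y) = ∑ k, reTr (S.H n * x.W k) + reTr (S.H n * x.Q) := by
  rw [Variables.Y, mul_add, Finset.mul_sum, reTr_add, reTr_sum]

theorem leakageLMI_reduceRank {x : Variables Nt N M I} {m : Fin M} {n : Fin N}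
    (hW : (x.W n).PosSemidef) (h : S.LeakageLMI x m n) : S.LeakageLMI (S.reduceRank x) m n := by
  have hc : (0 : ℂ) ≤ ((1 / (1 - Real.exp (-S.Rtilde m n)) : ℝ) : ℂ) := by
    have hR : 0 < S.Rtilde m n := div_pos (S.Rreq_pos m n) S.BW_pos
    have : Real.exp (-S.Rtilde m n) < 1 := Real.exp_lt_one_iff.mpr (neg_lt_zero.mpr hR)
    exact Complex.zero_le_real.mpr (one_div_nonneg.mpr (by linarith))
  have hX : S.X x m n - S.X (S.reduceRank x) m n =
      ((1 / (1 - Real.exp (-S.Rtilde m n)) : ℝ) : ℂ) •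
        (x.W n - rankOnePart (x.W n) (S.h n)) := by
    rw [X_eq_sub_Y, X_eq_sub_Y, Y_reduceRank, sub_sub_sub_cancel_right, smul_sub, reduceRank]
  have hD := (((posSemidef_sub_rankOnePart hW (S.h n)).smul hc).conjTranspose_mul_mul_same
    (augment (S.ge m)))
  rw [← hX, Matrix.mul_sub, Matrix.sub_mul] at hD
  have := Matrix.PosSemidef.add h hD
  rwa [sub_add_sub_cancel] at this

theorem reduceRank_mem_feasible [NeZero M] {t : ℝ} {x : Variables Nt N M I}
    (hx : x ∈ S.feasible t) : S.reduceRank x ∈ S.feasible t := by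
  obtain ⟨hζ, hη, hQ, hW, hL, hE, hR⟩ := hx
  refine ⟨hζ, hη, hQ.add (posSemidef_sum _ fun n _ => posSemidef_sub_rankOnePart (hW n) _),
    fun n => posSemidef_rankOnePart (hW n) _, fun m n => S.leakageLMI_reduceRank (hW n) (hL m n),
    fun i => ?_, fun n => ?_⟩
  · rw [HarvestLMI, Y_reduceRank]
    exact hE i
  · have h := hR n
    have hn : reTr (S.H n * (S.reduceRank x).W n) = reTr (S.H n * x.W n) :=
      congrArg Complex.re (trace_vecMulVec_star_mul_rankOnePart (x.W n) (S.h n))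
    rw [SecrecyConstraint, ← reTr_H_mul_Y] at h ⊢
    rwa [Y_reduceRank, hn]

theorem IsOptimal.reduceRank [NeZero M] {S : System Nt N M I} {t : ℝ} {x : Variables Nt N M I}
    (hx : S.IsOptimal t x) : S.IsOptimal t (S.reduceRank x) := by
  refine ⟨S.reduceRank_mem_feasible hx.1, fun y hy => ?_⟩
  rw [power_eq_reTr_Y, Y_reduceRank, ← power_eq_reTr_Y]
  exact hx.2 y hy

end System

end MisomeSwipt

theorem proposition3 {Nt N M I : ℕ} [NeZero M] (S : MisomeSwipt.System Nt N M I) (t : ℝ)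
    (hθ : ∀ n, S.θ n t ≠ 0) (hfeas : (S.feasible t).Nonempty) :
    ∃ x : MisomeSwipt.Variables Nt N M I, S.IsOptimal t x ∧ ∀ n, (x.W n).rank ≤ 1 := by
  obtain ⟨x, hx⟩ := S.exists_isOptimal t hfeas
  exact ⟨S.reduceRank x, hx.reduceRank, fun n => MisomeSwipt.rank_rankOnePart_le _ _⟩
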